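/- Let $s\in(0,1)$, let $n\ge 1$ be an integer with $n>2s$, put $2_s^*=\frac{2n}{n-2s}$, and let $\Omega\subset\mathbb{R}^n$ be a bounded domain with $C^{1,1}$ boundary. Let $a\in L^1(S^{n-1})$ be even with $\inf_{S^{n-1}}a>0$, and let $K(y)=a(y/|y|)\,|y|^{-(n+2s)}$ for $y\ne0$. Let $X(\Omega)$ be the space of all $u\in L^2(\mathbb{R}^n)$ such that $u=0$ a.e. in $\mathbb{R}^n\setminus\Omega$ and $\int_{\mathbb{R}^{2n}}|u(x)-u(y)|^2K(x-y)\,dx\,dy<\infty$. Let $f:\Omega\times\mathbb{R}\to\mathbb{R}$ be a Carathéodory function such that $$|f(x,t)|\le C(1+|t|^{q-1})\quad\text{for a.e. }x\in\Omega\text{ and all }t\in\mathbb{R},\tag{G}$$ with $C>0$ and $q\in[1,2_s^*]$. A weak solution of the problem $L_Ku=f(x,u)$ in $\Omega$, $u=0$ in $\mathbb{R}^n\setminus\Omega$, is a function $u\in X(\Omega)$ such that $$\int_{\mathbb{R}^{2n}}(u(x)-u(y))(v(x)-v(y))K(x-y)\,dx\,dy=\int_\Omega f(x,u(x))v(x)\,dx\quad\text{for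 all }v\in X(\Omega).$$ Then every weak solution $u\in X(\Omega)$ lies in $L^\infty(\Omega)$. Moreover, if $q<2_s^*$ and $\beta>0$, there is a continuous function $M:[0,\infty)\to[0,\infty)$, depending only on $C$, $q$, $n$, $s$, $\Omega$ and $\beta$, such that, whenever $a\ge\beta$ on $S^{n-1}$, every weak solution satisfies $$\|u\|_{L^\infty(\Omega)}\le M\big(\|u\|_{L^{2_s^*}(\Omega)}\big).$$ -/

import Mathlib

open MeasureTheory Metric Set
open scoped NNReal ENNReal RealInnerProductSpace

/-- The boundary of `Ω` is of class `C^{1,1}`: near each boundary point, and after a choice of a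
unit direction `ν`, the set `Ω` is the strict epigraph, in the direction `ν`, of a `C^1` function
with Lipschitz derivative on the hyperplane orthogonal to `ν`. -/
def HasC11Boundary {n : ℕ} (Ω : Set (EuclideanSpace ℝ (Fin n))) : Prop :=
  ∀ p ∈ frontier Ω, ∃ ν : EuclideanSpace ℝ (Fin n), ‖ν‖ = 1 ∧
    ∃ φ : ((ℝ ∙ ν)ᗮ : Submodule ℝ (EuclideanSpace ℝ (Fin n))) → ℝ,
      ContDiff ℝ 1 φ ∧ (∃ L : ℝ≥0, LipschitzWith L (fderiv ℝ φ)) ∧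
      ∃ r : ℝ, 0 < r ∧ ∀ x ∈ ball p r,
        (x ∈ Ω ↔ φ ((ℝ ∙ ν)ᗮ.orthogonalProjectionOnto x) < ⟪ν, x⟫)

/-- A bounded domain (nonempty connected open set) of `ℝⁿ` with `C^{1,1}` boundary. -/
structure IsBoundedC11Domain {n : ℕ} (Ω : Set (EuclideanSpace ℝ (Fin n))) : Prop where
  isOpen : IsOpen Ω
  isConnected : IsConnected Ω
  isBounded : Bornology.IsBounded Ω
  boundary : HasC11Boundary Ω

/-- The fractional critical exponent `2n / (n - 2s)`. -/
noncomputable def criticalExponent (n : ℕ) (s : ℝ) : ℝ := 2 * n / (n - 2 * s)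

/-- The angular weights: `a ∈ L¹(S^{n-1})` (with respect to the surface measure), `inf a > 0`,
and `a` is even. -/
structure IsAngularWeight {n : ℕ} (a : sphere (0 : EuclideanSpace ℝ (Fin n)) 1 → ℝ) : Prop where
  integrable : Integrable a (volume : Measure (EuclideanSpace ℝ (Fin n))).toSphere
  inf_pos : ∃ β : ℝ, 0 < β ∧ ∀ θ, β ≤ a θ
  even : ∀ θ, a (-θ) = a θ

open Classical in
/-- The kernel `K(y) = a(y/|y|) |y|^{-(n+2s)}` for `y ≠ 0`; its value at the origin is irrelevant
and set to `0`. -/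
noncomputable def kernel {n : ℕ} (s : ℝ) (a : sphere (0 : EuclideanSpace ℝ (Fin n)) 1 → ℝ)
    (y : EuclideanSpace ℝ (Fin n)) : ℝ :=
  if h : y = 0 then 0
  else a ⟨‖y‖⁻¹ • y, by simp [norm_smul, h]⟩ / ‖y‖ ^ ((n : ℝ) + 2 * s)

/-- The space `X(Ω)`: `u ∈ L²(ℝⁿ)` with `[u]_K < ∞` and `u = 0` almost everywhere outside `Ω`. -/
structure MemX {n : ℕ} (s : ℝ) (a : sphere (0 : EuclideanSpace ℝ (Fin n)) 1 → ℝ)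
    (Ω : Set (EuclideanSpace ℝ (Fin n))) (u : EuclideanSpace ℝ (Fin n) → ℝ) : Prop where
  memLp : MemLp u 2 volume
  seminorm_lt_top :
    ∫⁻ p : EuclideanSpace ℝ (Fin n) × EuclideanSpace ℝ (Fin n),
      ENNReal.ofReal (|u p.1 - u p.2| ^ 2 * kernel s a (p.1 - p.2)) < ∞
  eq_zero : ∀ᵐ x ∂(volume.restrict Ωᶜ), u x = 0

/-- The inner product of `X(Ω)`. -/
noncomputable def innerX {n : ℕ} (s : ℝ) (a : sphere (0 : EuclideanSpace ℝ (Fin n)) 1 → ℝ)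
    (u v : EuclideanSpace ℝ (Fin n) → ℝ) : ℝ :=
  ∫ p : EuclideanSpace ℝ (Fin n) × EuclideanSpace ℝ (Fin n),
    (u p.1 - u p.2) * (v p.1 - v p.2) * kernel s a (p.1 - p.2)

/-- `f` is a Carathéodory function on `Ω × ℝ` (only the values over `Ω` matter):
Lebesgue measurable in `x` for all `t`, continuous in `t` for almost every `x ∈ Ω`. -/
structure IsCaratheodory {n : ℕ} (Ω : Set (EuclideanSpace ℝ (Fin n)))
    (f : EuclideanSpace ℝ (Fin n) → ℝ → ℝ) : Prop where
  measurable : ∀ t : ℝ, AEMeasurable (fun x => f x t) (volume.restrict Ω)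
  continuous : ∀ᵐ x ∂(volume.restrict Ω), Continuous (f x)

/-- The growth condition `|f(x,t)| ≤ C (1 + |t|^{q-1})` for a.e. `x ∈ Ω` and all `t`. -/
def GrowthCondition {n : ℕ} (Ω : Set (EuclideanSpace ℝ (Fin n)))
    (f : EuclideanSpace ℝ (Fin n) → ℝ → ℝ) (C q : ℝ) : Prop :=
  ∀ᵐ x ∂(volume.restrict Ω), ∀ t : ℝ, |f x t| ≤ C * (1 + |t| ^ (q - 1))

/-- `u ∈ X(Ω)` is a weak solution of `L_K u = f(x,u)` in `Ω`, `u = 0` in `ℝⁿ ∖ Ω`. -/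
structure IsWeakSolution {n : ℕ} (s : ℝ) (a : sphere (0 : EuclideanSpace ℝ (Fin n)) 1 → ℝ)
    (Ω : Set (EuclideanSpace ℝ (Fin n))) (f : EuclideanSpace ℝ (Fin n) → ℝ → ℝ)
    (u : EuclideanSpace ℝ (Fin n) → ℝ) : Prop where
  memX : MemX s a Ω u
  weak_eq : ∀ v : EuclideanSpace ℝ (Fin n) → ℝ, MemX s a Ω v →
    innerX s a u v = ∫ x in Ω, f x (u x) * v x

/-!
Write `p = 2 / (1 - σ)` for the critical exponent, where `σ = 2 s / n`.

The proof is an `ε`-regularity argument, `exists_eps_forall_ae_le`. Suppose that above a level `K`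
the nonlinearity is at most `lam * t ^ (p - 1)`. Testing the equation with `(u - h)₊` and bounding
`u ≤ h / (h - k) * (u - k)` on the set `u > h` gives, for levels `K ≤ k < h`,
`[(u - h)₊]² ≤ (lam / β) (h / (h - k)) ^ p ∫ (u - k)₊ ^ p`
(`IsWeakSolution.mul_gagliardoEnergy_max_sub_le`). The fractional Sobolev inequality
(`exists_sobolev_const`) bounds the left-hand side from below by a multiple of
`(∫ (u - h)₊ ^ p) ^ (1 - σ)`. Along the levels `K (2 - 2⁻ʲ)` this is a superlinear recursion for
`∫ (u - k_j)₊ ^ p`, whose solution tends to zero (`le_mul_pow_of_superlinear`) as soon as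
`lam * (∫ (u - K)₊ ^ p) ^ σ` is below a constant depending only on `n`, `s`, `β`; then `u ≤ 2 K`.

Under the growth condition one may take `lam = 2 C K ^ (q - p)`. If `q = p`, smallness for large `K`
comes from the vanishing tail of the finite integral `∫ |u| ^ p`. If `q < p`, it comes from the
factor `K ^ (q - p)`, so that `K` depends on the solution only through a bound for its critical
norm, locally uniformly; a partition of unity turns the local bounds into a continuous function `M`.

The Sobolev inequality is proved directly for measurable functions, without density of smooth
functions. Comparing `w x` with its values on a ball about `x`
and optimising the radius gives `|w x| ^ p ≤ c (∫ |w| ^ p) ^ σ D(x)`, where the integral of `D` is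
the Gagliardo energy (`exists_enorm_rpow_le_inner_energy`); it remains to integrate in `x`.
-/

/-! ### The fractional Sobolev inequality -/

/-- The squared Gagliardo seminorm of order `s`, as an iterated integral in `[0, ∞]`. -/
noncomputable def gagliardoEnergy {E : Type*} [NormedAddCommGroup E] [NormedSpace ℝ E]
    [MeasurableSpace E] (μ : Measure E) (s : ℝ) (w : E → ℝ) : ℝ≥0∞ :=
  ∫⁻ x, ∫⁻ y, ENNReal.ofReal (|w x - w y| ^ 2 / ‖x - y‖ ^ (Module.finrank ℝ E + 2 * s)) ∂μ ∂μ

lemma gagliardoEnergy_mono {E : Type*} [NormedAddCommGroup E] [NormedSpace ℝ E]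
    [MeasurableSpace E] (μ : Measure E) {s : ℝ} {v w : E → ℝ}
    (h : ∀ x y, |v x - v y| ≤ |w x - w y|) :
    gagliardoEnergy μ s v ≤ gagliardoEnergy μ s w := by
  refine lintegral_mono fun x => lintegral_mono fun y => ENNReal.ofReal_le_ofReal ?_
  have := h x y
  gcongr

/-- Optimisation in the volume scale `m`: the two terms on the right balance at `m = ν / d`. -/
lemma rpow_le_of_forall_scale {σ ω ν d T : ℝ} (hσ1 : σ < 1) (hω : 0 < ω) (hν : 0 < ν)
    (hd : 0 ≤ d) (hT : 0 ≤ T)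
    (h : ∀ m : ℝ, 0 < m → T * (ω * m) ≤ 2 * (m ^ (1 + σ) * d) + 2 * (ν * (ω * m) ^ σ)) :
    T ^ (1 / (1 - σ)) ≤ (2 * (1 + ω ^ σ) / ω) ^ (1 / (1 - σ)) * ν ^ (σ / (1 - σ)) * d := by
  have h1σ : 0 < 1 - σ := by linarith
  have hωσ : 0 < ω ^ σ := Real.rpow_pos_of_pos hω _
  have hc : 0 < 2 * (1 + ω ^ σ) / ω := by positivity
  have key : ∀ e : ℝ, 0 < e → d ≤ e →
      T ^ (1 / (1 - σ)) ≤ (2 * (1 + ω ^ σ) / ω) ^ (1 / (1 - σ)) * ν ^ (σ / (1 - σ)) * e := by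
    intro e he hde
    have hm : 0 < ν / e := by positivity
    have h2 : T ≤ 2 * (1 + ω ^ σ) / ω * (ν ^ σ * e ^ (1 - σ)) := by
      have h3 := h (ν / e) hm
      have h4 : (ν / e) ^ (1 + σ) * d ≤ (ν / e) ^ (1 + σ) * e := by gcongr
      have e1 : (ν / e) ^ (1 + σ) * e = (ν / e) * (ν ^ σ * e ^ (1 - σ)) := by
        rw [Real.rpow_add hm, Real.rpow_one, Real.div_rpow hν.le he.le, Real.rpow_sub he,
          Real.rpow_one]
        field_simp
      have e2 : ν * (ω * (ν / e)) ^ σ = ω ^ σ * ((ν / e) * (ν ^ σ * e ^ (1 - σ))) := by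
        rw [Real.mul_rpow hω.le hm.le, Real.div_rpow hν.le he.le, Real.rpow_sub he,
          Real.rpow_one]
        field_simp
      rw [e2] at h3
      rw [e1] at h4
      rw [div_mul_eq_mul_div, le_div_iff₀ hω]
      refine le_of_mul_le_mul_right ?_ hm
      nlinarith
    calc T ^ (1 / (1 - σ))
        ≤ (2 * (1 + ω ^ σ) / ω * (ν ^ σ * e ^ (1 - σ))) ^ (1 / (1 - σ)) := by gcongr
      _ = _ := by
        rw [Real.mul_rpow hc.le (by positivity), Real.mul_rpow (by positivity) (by positivity),
          ← Real.rpow_mul hν.le, ← Real.rpow_mul he.le, mul_one_div, mul_one_div,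
          div_self h1σ.ne', Real.rpow_one, mul_assoc]
  rcases hd.eq_or_lt with rfl | hd
  · refine le_of_forall_pos_le_add fun δ hδ => ?_
    have hA : 0 < (2 * (1 + ω ^ σ) / ω) ^ (1 / (1 - σ)) * ν ^ (σ / (1 - σ)) := by positivity
    have := key (δ / ((2 * (1 + ω ^ σ) / ω) ^ (1 / (1 - σ)) * ν ^ (σ / (1 - σ))))
      (by positivity) (by positivity)
    rwa [mul_div_cancel₀ _ hA.ne', ← zero_add δ, ← mul_zero
      ((2 * (1 + ω ^ σ) / ω) ^ (1 / (1 - σ)) * ν ^ (σ / (1 - σ)))] at this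
  · exact key d hd le_rfl

/-- Hölder's inequality against the constant `1` on a set. -/
lemma setLIntegral_enorm_sq_le {E : Type*} [MeasurableSpace E] (μ : Measure E) {σ : ℝ}
    (hσ : 0 < σ) (hσ1 : σ < 1) {w : E → ℝ}
    (hw : AEMeasurable w μ) (B : Set E) :
    ∫⁻ y in B, ‖w y‖ₑ ^ (2 : ℝ) ∂μ
      ≤ (∫⁻ y, ‖w y‖ₑ ^ (2 / (1 - σ)) ∂μ) ^ (1 - σ) * μ B ^ σ := by
  have h1σ : 0 < 1 - σ := by linarith
  have hpq : (1 / (1 - σ)).HolderConjugate (1 / σ) := by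
    rw [Real.holderConjugate_iff]
    constructor
    · rw [lt_div_iff₀ h1σ]; linarith
    · simp
  have := ENNReal.lintegral_mul_le_Lp_mul_Lq (μ.restrict B) hpq
    (f := fun y => ‖w y‖ₑ ^ (2 : ℝ)) (g := fun _ => 1)
    ((hw.restrict.enorm).pow_const _) aemeasurable_const
  simp only [Pi.mul_apply, mul_one, ENNReal.one_rpow, one_div_one_div, lintegral_const,
    Measure.restrict_apply MeasurableSet.univ, univ_inter, one_mul] at this
  refine this.trans ?_
  gcongr ?_ * _
  refine ENNReal.rpow_le_rpow ?_ h1σ.le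
  refine (lintegral_mono' Measure.restrict_le_self le_rfl).trans (le_of_eq ?_)
  refine lintegral_congr fun y => ?_
  rw [← ENNReal.rpow_mul, mul_one_div]

/-- Comparing `w x` with the values of `w` on the ball of radius `r` about `x`. -/
lemma ofReal_sq_mul_measure_ball_le {E : Type*} [NormedAddCommGroup E] [NormedSpace ℝ E]
    [MeasurableSpace E] [BorelSpace E] (μ : Measure E) {s σ : ℝ}
    (hs : 0 < s) (hσ : 0 < σ) (hσ1 : σ < 1) {w : E → ℝ} (hw : AEMeasurable w μ) (x : E) (r : ℝ) :
    ENNReal.ofReal (w x ^ 2) * μ (ball x r) ≤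
      2 * (ENNReal.ofReal (r ^ (Module.finrank ℝ E + 2 * s)) *
        ∫⁻ y, ENNReal.ofReal (|w x - w y| ^ 2 / ‖x - y‖ ^ (Module.finrank ℝ E + 2 * s)) ∂μ) +
      2 * ((∫⁻ y, ‖w y‖ₑ ^ (2 / (1 - σ)) ∂μ) ^ (1 - σ) * μ (ball x r) ^ σ) := by
  set e : ℝ := Module.finrank ℝ E + 2 * s with he
  have he0 : 0 < e := by positivity
  have hpt : ∀ y ∈ ball x r, ENNReal.ofReal (w x ^ 2) ≤
      2 * (ENNReal.ofReal (r ^ e) * ENNReal.ofReal (|w x - w y| ^ 2 / ‖x - y‖ ^ e)) +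
        2 * ‖w y‖ₑ ^ (2 : ℝ) := by
    intro y hy
    have hyr : ‖x - y‖ < r := by rwa [mem_ball', dist_eq_norm] at hy
    have hr : 0 < r := (norm_nonneg _).trans_lt hyr
    have h1 : |w x - w y| ^ 2 ≤ r ^ e * (|w x - w y| ^ 2 / ‖x - y‖ ^ e) := by
      rcases eq_or_ne x y with rfl | hxy
      · simp
      · have : 0 < ‖x - y‖ := norm_pos_iff.2 (sub_ne_zero.2 hxy)
        have h2 : ‖x - y‖ ^ e ≤ r ^ e := by gcongr
        have h3 : 0 < ‖x - y‖ ^ e := by positivity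
        rw [mul_div_assoc', le_div_iff₀ h3, mul_comm]
        gcongr
    have h2 : w x ^ 2 ≤ 2 * (r ^ e * (|w x - w y| ^ 2 / ‖x - y‖ ^ e)) + 2 * |w y| ^ 2 := by
      rw [sq_abs] at h1 ⊢
      rw [sq_abs]
      nlinarith [sq_nonneg (w x - 2 * w y)]
    have h3 : ‖w y‖ₑ ^ (2 : ℝ) = ENNReal.ofReal (|w y| ^ 2) := by
      rw [Real.enorm_eq_ofReal_abs, ENNReal.ofReal_rpow_of_nonneg (abs_nonneg _) (by norm_num),
        Real.rpow_two]
    have two : (2 : ℝ≥0∞) = ENNReal.ofReal 2 := by simp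
    rw [h3, two, ← ENNReal.ofReal_mul (by positivity), ← ENNReal.ofReal_mul (by positivity),
      ← ENNReal.ofReal_mul (by positivity), ← ENNReal.ofReal_add (by positivity) (by positivity)]
    exact ENNReal.ofReal_le_ofReal h2
  calc ENNReal.ofReal (w x ^ 2) * μ (ball x r)
      = ∫⁻ _ in ball x r, ENNReal.ofReal (w x ^ 2) ∂μ := by rw [setLIntegral_const]
    _ ≤ ∫⁻ y in ball x r, (2 * (ENNReal.ofReal (r ^ e) *
          ENNReal.ofReal (|w x - w y| ^ 2 / ‖x - y‖ ^ e)) + 2 * ‖w y‖ₑ ^ (2 : ℝ)) ∂μ :=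
        setLIntegral_mono' measurableSet_ball hpt
    _ = 2 * (ENNReal.ofReal (r ^ e) * ∫⁻ y in ball x r,
          ENNReal.ofReal (|w x - w y| ^ 2 / ‖x - y‖ ^ e) ∂μ) +
          2 * ∫⁻ y in ball x r, ‖w y‖ₑ ^ (2 : ℝ) ∂μ := by
        rw [lintegral_add_right' _ ((hw.restrict.enorm.pow_const _).const_mul _),
          lintegral_const_mul' _ _ (by simp), lintegral_const_mul' _ _ (by simp),
          lintegral_const_mul' _ _ (by simp)]
    _ ≤ _ := by
        gcongr
        · exact Measure.restrict_le_self
        · exact setLIntegral_enorm_sq_le μ hσ hσ1 hw _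

section Sobolev

variable {E : Type*} [NormedAddCommGroup E] [NormedSpace ℝ E] [MeasurableSpace E] [BorelSpace E]
  [FiniteDimensional ℝ E] (μ : Measure E) [μ.IsAddHaarMeasure] {s σ : ℝ}

/-- The pointwise bound `|w x|^p ≤ c (∫ |w|^p)^σ D(x)`, where `p = 2 / (1 - σ)` and `D(x)` is the
inner integral of the Gagliardo energy. -/
lemma exists_enorm_rpow_le_inner_energy (hs : 0 < s) (hE : 2 * s < Module.finrank ℝ E)
    (hσ : σ = 2 * s / Module.finrank ℝ E) :
    ∃ c : ℝ≥0, ∀ w : E → ℝ, AEMeasurable w μ →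
      ∫⁻ y, ‖w y‖ₑ ^ (2 / (1 - σ)) ∂μ ≠ 0 → ∫⁻ y, ‖w y‖ₑ ^ (2 / (1 - σ)) ∂μ ≠ ∞ →
      ∀ x, ‖w x‖ₑ ^ (2 / (1 - σ)) ≤ c * (∫⁻ y, ‖w y‖ₑ ^ (2 / (1 - σ)) ∂μ) ^ σ *
        ∫⁻ y, ENNReal.ofReal (|w x - w y| ^ 2 / ‖x - y‖ ^ (Module.finrank ℝ E + 2 * s)) ∂μ := by
  have hn : (0 : ℝ) < Module.finrank ℝ E := by linarith
  have hσ0 : 0 < σ := by rw [hσ]; positivity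
  have hσ1 : σ < 1 := by rw [hσ, div_lt_one hn]; exact hE
  have h1σ : 0 < 1 - σ := by linarith
  have : Nontrivial E := (Module.finrank_pos_iff (R := ℝ)).1 (by exact_mod_cast hn)
  set ω : ℝ := (μ (ball (0 : E) 1)).toReal with hω
  have hωt : μ (ball (0 : E) 1) ≠ ∞ := measure_ball_lt_top.ne
  have hω0 : 0 < ω := ENNReal.toReal_pos (measure_ball_pos μ _ one_pos).ne' hωt
  refine ⟨Real.toNNReal ((2 * (1 + ω ^ σ) / ω) ^ (1 / (1 - σ))), fun w hw hN0 hNt x => ?_⟩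
  set N := ∫⁻ y, ‖w y‖ₑ ^ (2 / (1 - σ)) ∂μ with hN
  set D := ∫⁻ y, ENNReal.ofReal (|w x - w y| ^ 2 / ‖x - y‖ ^ (Module.finrank ℝ E + 2 * s)) ∂μ
    with hD
  have hNr : 0 < N.toReal := ENNReal.toReal_pos hN0 hNt
  have hNofReal : N = ENNReal.ofReal N.toReal := (ENNReal.ofReal_toReal hNt).symm
  have hc : 0 < (2 * (1 + ω ^ σ) / ω) ^ (1 / (1 - σ)) := by positivity
  rcases eq_or_ne D ∞ with hDt | hDt
  · rw [hDt, ENNReal.mul_top]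
    · exact le_top
    · refine mul_ne_zero ?_ ?_
      · simpa using hc
      · rw [hNofReal, ENNReal.ofReal_rpow_of_pos hNr]
        simpa using Real.rpow_pos_of_pos hNr σ
  have hDofReal : D = ENNReal.ofReal D.toReal := (ENNReal.ofReal_toReal hDt).symm
  have main : (w x ^ 2) ^ (1 / (1 - σ)) ≤ (2 * (1 + ω ^ σ) / ω) ^ (1 / (1 - σ)) *
      (N.toReal ^ (1 - σ)) ^ (σ / (1 - σ)) * D.toReal := by
    refine rpow_le_of_forall_scale hσ1 hω0 (by positivity) ENNReal.toReal_nonneg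
      (sq_nonneg _) fun m hm => ?_
    -- the radius of volume scale `m`
    set r : ℝ := m ^ (1 / (Module.finrank ℝ E : ℝ)) with hr
    have hr0 : 0 < r := Real.rpow_pos_of_pos hm _
    have hrn : r ^ (Module.finrank ℝ E) = m := by
      rw [← Real.rpow_natCast, hr, ← Real.rpow_mul hm.le, one_div_mul_cancel hn.ne',
        Real.rpow_one]
    have hre : r ^ ((Module.finrank ℝ E : ℝ) + 2 * s) = m ^ (1 + σ) := by
      rw [hr, ← Real.rpow_mul hm.le, hσ]
      congr 1
      field_simp
    have hball : μ (ball x r) = ENNReal.ofReal (ω * m) := by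
      rw [Measure.addHaar_ball μ x hr0.le, hrn, ← ENNReal.ofReal_toReal hωt,
        ← ENNReal.ofReal_mul hm.le, mul_comm]
    have h := ofReal_sq_mul_measure_ball_le μ hs hσ0 hσ1 hw x r
    rw [← hN, ← hD, hball, hre, hNofReal, hDofReal, ENNReal.ofReal_rpow_of_pos hNr,
      ENNReal.ofReal_rpow_of_pos (by positivity : 0 < ω * m),
      show (2 : ℝ≥0∞) = ENNReal.ofReal 2 by simp,
      ← ENNReal.ofReal_mul (by positivity), ← ENNReal.ofReal_mul (by positivity),
      ← ENNReal.ofReal_mul (by positivity), ← ENNReal.ofReal_mul (by positivity),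
      ← ENNReal.ofReal_mul (by positivity),
      ← ENNReal.ofReal_add (by positivity) (by positivity),
      ENNReal.ofReal_le_ofReal_iff (by positivity)] at h
    exact h
  have e1 : (N.toReal ^ (1 - σ)) ^ (σ / (1 - σ)) = N.toReal ^ σ := by
    rw [← Real.rpow_mul hNr.le, mul_div_cancel₀ _ h1σ.ne']
  have e2 : (w x ^ 2) ^ (1 / (1 - σ)) = |w x| ^ (2 / (1 - σ)) := by
    rw [← sq_abs, ← Real.rpow_two, ← Real.rpow_mul (abs_nonneg _), mul_one_div]
  rw [e1, e2] at main
  have e3 : ((Real.toNNReal ((2 * (1 + ω ^ σ) / ω) ^ (1 / (1 - σ))) : ℝ≥0) : ℝ≥0∞)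
      = ENNReal.ofReal ((2 * (1 + ω ^ σ) / ω) ^ (1 / (1 - σ))) := rfl
  rw [Real.enorm_eq_ofReal_abs, ENNReal.ofReal_rpow_of_nonneg (abs_nonneg _) (by positivity),
    e3, hNofReal, hDofReal, ENNReal.ofReal_rpow_of_pos hNr, ← ENNReal.ofReal_mul hc.le,
    ← ENNReal.ofReal_mul (by positivity)]
  exact ENNReal.ofReal_le_ofReal main

/-- The fractional Sobolev inequality at the critical exponent `p = 2 / (1 - σ)`. Integrating the
pointwise bound gives `N ≤ c N^σ [w]²` for `N = ∫ |w|^p`; dividing by `N^σ` requires `N < ∞`, which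
is arranged by truncation. -/
theorem exists_sobolev_const (hs : 0 < s) (hE : 2 * s < Module.finrank ℝ E)
    (hσ : σ = 2 * s / Module.finrank ℝ E) :
    ∃ S : ℝ≥0, ∀ w : E → ℝ, MemLp w 2 μ →
      (∫⁻ y, ‖w y‖ₑ ^ (2 / (1 - σ)) ∂μ) ^ (1 - σ) ≤ S * gagliardoEnergy μ s w := by
  have hn : (0 : ℝ) < Module.finrank ℝ E := by linarith
  have hσ0 : 0 < σ := by rw [hσ]; positivity
  have hσ1 : σ < 1 := by rw [hσ, div_lt_one hn]; exact hE
  have h1σ : 0 < 1 - σ := by linarith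
  have hp2 : 2 ≤ 2 / (1 - σ) := by rw [le_div_iff₀ h1σ]; linarith
  obtain ⟨c, hc⟩ := exists_enorm_rpow_le_inner_energy μ hs hE hσ
  have fin : ∀ w : E → ℝ, AEMeasurable w μ → ∫⁻ y, ‖w y‖ₑ ^ (2 / (1 - σ)) ∂μ ≠ ∞ →
      (∫⁻ y, ‖w y‖ₑ ^ (2 / (1 - σ)) ∂μ) ^ (1 - σ) ≤ c * gagliardoEnergy μ s w := by
    intro w hw hNt
    rcases eq_or_ne (∫⁻ y, ‖w y‖ₑ ^ (2 / (1 - σ)) ∂μ) 0 with h0 | h0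
    · rw [h0, ENNReal.zero_rpow_of_pos h1σ]; exact zero_le
    have h := lintegral_mono (μ := μ) (hc w hw h0 hNt)
    set N := ∫⁻ y, ‖w y‖ₑ ^ (2 / (1 - σ)) ∂μ with hN
    have hNσt : N ^ σ ≠ ∞ := ENNReal.rpow_ne_top_of_nonneg hσ0.le hNt
    have hNσ0 : N ^ σ ≠ 0 := by simp [ENNReal.rpow_eq_zero_iff, h0, hNt]
    rw [lintegral_const_mul' _ _ (ENNReal.mul_ne_top ENNReal.coe_ne_top hNσt)] at h
    rw [ENNReal.rpow_sub _ _ h0 hNt, ENNReal.rpow_one]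
    refine ENNReal.div_le_of_le_mul ?_
    calc N ≤ _ := h
      _ = _ := by rw [gagliardoEnergy]; ring
  refine ⟨c, fun w hw => ?_⟩
  have hwm : AEMeasurable w μ := hw.aemeasurable
  have htm : ∀ T : ℕ, AEMeasurable (fun x => min |w x| (T : ℝ)) μ := fun T =>
    ((continuous_abs.measurable.comp_aemeasurable hwm)).min aemeasurable_const
  have hen : ∀ (T : ℕ) x, ‖min |w x| (T : ℝ)‖ₑ = min ‖w x‖ₑ (T : ℝ≥0∞) := by
    intro T x
    rw [Real.enorm_eq_ofReal (by positivity), Real.enorm_eq_ofReal_abs, ENNReal.ofReal_min,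
      ENNReal.ofReal_natCast]
  have hsq : ∫⁻ x, ‖w x‖ₑ ^ (2 : ℝ) ∂μ ≠ ∞ := by
    have := lintegral_rpow_enorm_lt_top_of_eLpNorm_lt_top two_ne_zero ENNReal.ofNat_ne_top hw.2
    simpa using this.ne
  have hT : ∀ T : ℕ, (∫⁻ y, (min ‖w y‖ₑ (T : ℝ≥0∞)) ^ (2 / (1 - σ)) ∂μ) ^ (1 - σ)
      ≤ c * gagliardoEnergy μ s w := by
    intro T
    have h1 : ∫⁻ y, ‖min |w y| (T : ℝ)‖ₑ ^ (2 / (1 - σ)) ∂μ ≠ ∞ := by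
      refine ne_top_of_le_ne_top
        (ENNReal.mul_ne_top (a := (T : ℝ≥0∞) ^ (2 / (1 - σ) - 2)) ?_ hsq) ?_
      · exact ENNReal.rpow_ne_top_of_nonneg (by linarith) (ENNReal.natCast_ne_top T)
      · rw [← lintegral_const_mul' _ _
          (ENNReal.rpow_ne_top_of_nonneg (by linarith) (ENNReal.natCast_ne_top T))]
        refine lintegral_mono fun y => ?_
        rw [hen, ← sub_add_cancel (2 / (1 - σ)) 2,
          ENNReal.rpow_add_of_nonneg _ _ (by linarith) (by norm_num), sub_add_cancel]
        refine mul_le_mul' (ENNReal.rpow_le_rpow (min_le_right _ _) (by linarith))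
          (ENNReal.rpow_le_rpow (min_le_left _ _) (by norm_num))
    have h2 := fin _ (htm T) h1
    simp only [hen] at h2
    refine h2.trans ?_
    gcongr
    refine gagliardoEnergy_mono μ fun x y => ?_
    have := abs_min_sub_min_le_max |w x| (T : ℝ) |w y| T
    rw [sub_self, abs_zero, max_eq_left (abs_nonneg _)] at this
    exact this.trans (abs_abs_sub_abs_le_abs_sub _ _)
  have hsup : ∫⁻ y, ‖w y‖ₑ ^ (2 / (1 - σ)) ∂μ
      = ⨆ T : ℕ, ∫⁻ y, (min ‖w y‖ₑ (T : ℝ≥0∞)) ^ (2 / (1 - σ)) ∂μ := by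
    rw [← lintegral_iSup']
    · refine lintegral_congr fun y => le_antisymm ?_ (iSup_le fun T => ?_)
      · obtain ⟨T, hT⟩ := ENNReal.exists_nat_gt (enorm_ne_top (x := w y))
        refine le_iSup_of_le T ?_
        rw [min_eq_left hT.le]
      · gcongr
        exact min_le_left _ _
    · intro T
      exact (hwm.enorm.min aemeasurable_const).pow_const _
    · refine Filter.Eventually.of_forall fun y T T' hTT' => ?_
      dsimp only
      gcongr
  rw [← ENNReal.le_rpow_inv_iff h1σ, hsup]
  exact iSup_le fun T => (ENNReal.le_rpow_inv_iff h1σ).2 (hT T)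

end Sobolev

/-! ### The energy of truncations -/

section Energy

variable {n : ℕ} {s : ℝ} {a : sphere (0 : EuclideanSpace ℝ (Fin n)) 1 → ℝ}
  {Ω : Set (EuclideanSpace ℝ (Fin n))} {u : EuclideanSpace ℝ (Fin n) → ℝ}

/-- In polar coordinates the kernel is an a.e. measurable function of the angle times a function
of the radius. -/
lemma IsAngularWeight.aemeasurable_kernel (ha : IsAngularWeight a) (s : ℝ) :
    AEMeasurable (kernel s a) volume := by
  have h0 : MeasurableSet ({0}ᶜ : Set (EuclideanSpace ℝ (Fin n))) :=
    (measurableSet_singleton 0).compl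
  have hind : ({0}ᶜ : Set (EuclideanSpace ℝ (Fin n))).indicator (kernel s a) = kernel s a := by
    rw [indicator_eq_self]
    intro y hy
    contrapose! hy
    simp only [mem_compl_iff, mem_singleton_iff, not_not] at hy
    simp [kernel, hy]
  rw [← hind, aemeasurable_indicator_iff h0, aemeasurable_restrict_iff_comap_subtype h0]
  have hfst : AEMeasurable (fun y : ({0}ᶜ : Set (EuclideanSpace ℝ (Fin n))) =>
      a (homeomorphUnitSphereProd (EuclideanSpace ℝ (Fin n)) y).1)
      (Measure.comap Subtype.val volume) :=
    (ha.integrable.aemeasurable.comp_quasiMeasurePreserving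
      Measure.quasiMeasurePreserving_fst).comp_quasiMeasurePreserving
      (volume.measurePreserving_homeomorphUnitSphereProd).quasiMeasurePreserving
  have hnorm : Measurable (fun y : ({0}ᶜ : Set (EuclideanSpace ℝ (Fin n))) =>
      ‖(y : EuclideanSpace ℝ (Fin n))‖ ^ ((n : ℝ) + 2 * s)) :=
    (measurable_subtype_coe.norm).pow_const _
  refine (hfst.div hnorm.aemeasurable).congr (Filter.Eventually.of_forall fun y => ?_)
  have hy : (y : EuclideanSpace ℝ (Fin n)) ≠ 0 := y.2
  simp only [Function.comp_apply, kernel, dif_neg hy, Pi.div_apply]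
  congr 2
  exact Subtype.ext (homeomorphUnitSphereProd_apply_fst_coe _ y)

lemma kernel_nonneg (ha : ∀ θ, 0 ≤ a θ) (y : EuclideanSpace ℝ (Fin n)) : 0 ≤ kernel s a y := by
  unfold kernel
  split_ifs with h
  · exact le_rfl
  · exact div_nonneg (ha _) (by positivity)

lemma IsAngularWeight.nonneg (ha : IsAngularWeight a) (θ) : 0 ≤ a θ := by
  obtain ⟨β, hβ, h⟩ := ha.inf_pos
  exact hβ.le.trans (h θ)

lemma IsAngularWeight.aemeasurable_kernel_sub (ha : IsAngularWeight a) (s : ℝ) :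
    AEMeasurable (fun p : EuclideanSpace ℝ (Fin n) × EuclideanSpace ℝ (Fin n) =>
      kernel s a (p.1 - p.2)) volume :=
  (ha.aemeasurable_kernel s).comp_quasiMeasurePreserving (quasiMeasurePreserving_sub volume volume)

lemma aemeasurable_fst_sub_snd {w : EuclideanSpace ℝ (Fin n) → ℝ} (hw : AEMeasurable w volume) :
    AEMeasurable (fun p : EuclideanSpace ℝ (Fin n) × EuclideanSpace ℝ (Fin n) =>
      w p.1 - w p.2) volume :=
  (hw.comp_quasiMeasurePreserving Measure.quasiMeasurePreserving_fst).sub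
    (hw.comp_quasiMeasurePreserving Measure.quasiMeasurePreserving_snd)

/-- The Gagliardo energy is controlled by the energy of the kernel. -/
lemma mul_gagliardoEnergy_le (ha : IsAngularWeight a) {β : ℝ} (hβ : 0 < β) (haβ : ∀ θ, β ≤ a θ)
    {w : EuclideanSpace ℝ (Fin n) → ℝ} (hw : AEMeasurable w volume) :
    ENNReal.ofReal β * gagliardoEnergy volume s w ≤
      ∫⁻ p : EuclideanSpace ℝ (Fin n) × EuclideanSpace ℝ (Fin n),
        ENNReal.ofReal (|w p.1 - w p.2| ^ 2 * kernel s a (p.1 - p.2)) := by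
  have hm : AEMeasurable (fun p : EuclideanSpace ℝ (Fin n) × EuclideanSpace ℝ (Fin n) =>
      ENNReal.ofReal (|w p.1 - w p.2| ^ 2 * kernel s a (p.1 - p.2))) volume := by
    simp only [sq_abs]
    exact (((aemeasurable_fst_sub_snd hw).pow_const 2).mul
      (ha.aemeasurable_kernel_sub s)).ennreal_ofReal
  rw [Measure.volume_eq_prod] at hm ⊢
  rw [lintegral_prod _ hm, gagliardoEnergy, ← lintegral_const_mul' _ _ ENNReal.ofReal_ne_top]
  refine lintegral_mono fun x => ?_
  rw [← lintegral_const_mul' _ _ ENNReal.ofReal_ne_top]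
  refine lintegral_mono fun y => ?_
  rw [← ENNReal.ofReal_mul hβ.le]
  refine ENNReal.ofReal_le_ofReal ?_
  simp only [finrank_euclideanSpace, Fintype.card_fin]
  rcases eq_or_ne x y with rfl | hxy
  · simp
  · rw [kernel, dif_neg (sub_ne_zero.2 hxy), mul_div_left_comm]
    have := haβ ⟨‖x - y‖⁻¹ • (x - y), by simp [norm_smul, sub_ne_zero.2 hxy]⟩
    gcongr

/-- Truncation at a level: the square of the truncated difference is at most the mixed product
that occurs when the equation is tested with the truncation. -/
lemma sq_abs_sub_max_le (b c k : ℝ) :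
    |max (b - k) 0 - max (c - k) 0| ^ 2 ≤ (b - c) * (max (b - k) 0 - max (c - k) 0) := by
  rw [sq_abs]
  rcases max_cases (b - k) 0 with ⟨h1, h2⟩ | ⟨h1, h2⟩ <;>
  rcases max_cases (c - k) 0 with ⟨h3, h4⟩ | ⟨h3, h4⟩ <;> rw [h1, h3] <;> nlinarith

lemma abs_sub_max_le (b c k : ℝ) : |max (b - k) 0 - max (c - k) 0| ≤ |b - c| := by
  have := abs_max_sub_max_le_max (b - k) 0 (c - k) 0
  simpa using this

lemma abs_max_sub_le {k : ℝ} (hk : 0 ≤ k) (b : ℝ) : |max (b - k) 0| ≤ |b| := by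
  rw [abs_of_nonneg (le_max_right _ _)]
  exact max_le (by linarith [le_abs_self b]) (abs_nonneg b)

lemma MemX.max_sub (hu : MemX s a Ω u) (ha : ∀ θ, 0 ≤ a θ) {k : ℝ} (hk : 0 ≤ k) :
    MemX s a Ω (fun x => max (u x - k) 0) where
  memLp := hu.memLp.mono
    ((hu.memLp.aemeasurable.sub_const k).max aemeasurable_const).aestronglyMeasurable
    (Filter.Eventually.of_forall fun x => abs_max_sub_le hk (u x))
  seminorm_lt_top := by
    refine lt_of_le_of_lt (lintegral_mono fun p => ENNReal.ofReal_le_ofReal ?_) hu.seminorm_lt_top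
    have := abs_sub_max_le (u p.1) (u p.2) k
    have := kernel_nonneg (s := s) ha (p.1 - p.2)
    gcongr
  eq_zero := by
    filter_upwards [hu.eq_zero] with x hx
    simp [hx, hk]

/-- Testing with `(u - k)₊` controls its energy. -/
lemma lintegral_max_sub_le_innerX (hu : MemX s a Ω u) (ha : IsAngularWeight a) {k : ℝ} :
    ∫⁻ p : EuclideanSpace ℝ (Fin n) × EuclideanSpace ℝ (Fin n),
        ENNReal.ofReal (|max (u p.1 - k) 0 - max (u p.2 - k) 0| ^ 2 * kernel s a (p.1 - p.2))
      ≤ ENNReal.ofReal (innerX s a u (fun x => max (u x - k) 0)) := by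
  have hum := hu.memLp.aemeasurable
  have hK := kernel_nonneg (s := s) ha.nonneg
  have hpos : ∀ p : EuclideanSpace ℝ (Fin n) × EuclideanSpace ℝ (Fin n),
      0 ≤ (u p.1 - u p.2) * (max (u p.1 - k) 0 - max (u p.2 - k) 0) * kernel s a (p.1 - p.2) :=
    fun p => mul_nonneg ((sq_nonneg _).trans (sq_abs_sub_max_le _ _ k)) (hK _)
  have hint : Integrable (fun p : EuclideanSpace ℝ (Fin n) × EuclideanSpace ℝ (Fin n) =>
      (u p.1 - u p.2) * (max (u p.1 - k) 0 - max (u p.2 - k) 0) * kernel s a (p.1 - p.2))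
      volume := by
    refine ⟨(((aemeasurable_fst_sub_snd hum).mul (aemeasurable_fst_sub_snd
      ((hum.sub_const k).max aemeasurable_const))).mul
      (ha.aemeasurable_kernel_sub s)).aestronglyMeasurable, ?_⟩
    refine lt_of_le_of_lt (lintegral_mono fun p => ?_) hu.seminorm_lt_top
    rw [Real.enorm_eq_ofReal (hpos p)]
    refine ENNReal.ofReal_le_ofReal (mul_le_mul_of_nonneg_right ?_ (hK _))
    refine (le_abs_self _).trans ?_
    rw [abs_mul, sq]
    exact mul_le_mul_of_nonneg_left (abs_sub_max_le _ _ k) (abs_nonneg _)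
  rw [innerX, ofReal_integral_eq_lintegral_ofReal hint (Filter.Eventually.of_forall hpos)]
  exact lintegral_mono fun p => ENNReal.ofReal_le_ofReal
    (mul_le_mul_of_nonneg_right (sq_abs_sub_max_le _ _ k) (hK _))

/-- Between two truncation levels `k < h`, one has `u ≤ h / (h - k) * (u - k)` where `u > h`, so
that `u ^ (p - 1) (u - h)₊` is dominated by a power of the lower truncation. -/
lemma rpow_mul_max_sub_le {p h k t : ℝ} (hp : 1 ≤ p) (hk : 0 ≤ k) (hkh : k < h) (ht : h < t) :
    t ^ (p - 1) * max (t - h) 0 ≤ (h / (h - k)) ^ p * max (t - k) 0 ^ p := by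
  have hhk : 0 < h - k := sub_pos.2 hkh
  have ht0 : 0 < t := by linarith
  rw [max_eq_left (by linarith), max_eq_left (by linarith),
    ← Real.mul_rpow (div_nonneg (by linarith) hhk.le) (by linarith)]
  calc t ^ (p - 1) * (t - h) ≤ t ^ (p - 1) * t := by gcongr; linarith
    _ = t ^ p := by rw [← Real.rpow_add_one ht0.ne', sub_add_cancel]
    _ ≤ _ := by
      gcongr
      rw [div_mul_eq_mul_div, le_div_iff₀ hhk]
      nlinarith

/-- The level-to-level estimate behind the De Giorgi iteration. -/
lemma IsWeakSolution.mul_gagliardoEnergy_max_sub_le {f : EuclideanSpace ℝ (Fin n) → ℝ → ℝ}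
    (hu : IsWeakSolution s a Ω f u) (ha : IsAngularWeight a) {β : ℝ} (hβ : 0 < β)
    (haβ : ∀ θ, β ≤ a θ) {p lam K h k : ℝ} (hp : 1 ≤ p) (hlam : 0 ≤ lam) (hK : 0 ≤ K)
    (hKk : K ≤ k) (hkh : k < h)
    (hf : ∀ᵐ x ∂(volume.restrict Ω), ∀ t : ℝ, K ≤ t → |f x t| ≤ lam * t ^ (p - 1)) :
    ENNReal.ofReal β * gagliardoEnergy volume s (fun x => max (u x - h) 0) ≤
      ENNReal.ofReal (lam * (h / (h - k)) ^ p) * ∫⁻ x, ‖max (u x - k) 0‖ₑ ^ p := by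
  have hhk : 0 < h - k := sub_pos.2 hkh
  have hh : 0 ≤ h := by linarith
  have hw := hu.memX.max_sub ha.nonneg hh
  refine (mul_gagliardoEnergy_le ha hβ haβ hw.memLp.aemeasurable).trans ?_
  refine (lintegral_max_sub_le_innerX hu.memX ha).trans ?_
  rw [hu.weak_eq _ hw]
  refine (ENNReal.ofReal_le_ofReal (le_abs_self _)).trans ?_
  rw [← Real.enorm_eq_ofReal_abs]
  -- for a non-integrable integrand the Bochner integral is `0` and the bound is still correct
  refine (enorm_integral_le_lintegral_enorm _).trans ?_
  rw [← lintegral_const_mul' _ _ ENNReal.ofReal_ne_top]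
  refine le_trans (lintegral_mono_ae ?_) (lintegral_mono' Measure.restrict_le_self le_rfl)
  filter_upwards [hf] with x hx
  rcases le_or_gt (u x) h with hxh | hxh
  · rw [max_eq_right (by linarith : u x - h ≤ 0)]
    simp
  · rw [Real.enorm_eq_ofReal_abs, Real.enorm_eq_ofReal (le_max_right _ _),
      ENNReal.ofReal_rpow_of_nonneg (le_max_right _ _) (by linarith),
      ← ENNReal.ofReal_mul (by positivity)]
    refine ENNReal.ofReal_le_ofReal ?_
    rw [abs_mul, abs_of_nonneg (le_max_right (u x - h) 0), mul_assoc]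
    calc |f x (u x)| * max (u x - h) 0 ≤ lam * u x ^ (p - 1) * max (u x - h) 0 := by
          gcongr
          exact hx _ (by linarith)
      _ ≤ _ := by
        rw [mul_assoc]
        refine mul_le_mul_of_nonneg_left ?_ hlam
        exact rpow_mul_max_sub_le hp (hK.trans hKk) hkh hxh

end Energy

/-! ### De Giorgi iteration -/

/-- Fast geometric convergence: a superlinear recursion with geometrically growing constants decays
geometrically when it starts small enough. -/
lemma le_mul_pow_of_superlinear {σ A b ρ : ℝ} {y : ℕ → ℝ} (hσ : 0 < σ) (hσ1 : σ < 1)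
    (hy : ∀ j, 0 ≤ y j) (hA : 0 ≤ A) (hb : 0 ≤ b) (hρ : 0 < ρ) (hρb : ρ ^ σ * b = 1)
    (h : ∀ j, y (j + 1) ^ (1 - σ) ≤ A * b ^ j * y j) (h0 : A * y 0 ^ σ ≤ ρ ^ (1 - σ)) (j : ℕ) :
    y j ≤ y 0 * ρ ^ j := by
  have h1σ : 0 < 1 - σ := by linarith
  induction j with
  | zero => simp
  | succ j ih =>
    have hρj : 0 < ρ ^ j := pow_pos hρ j
    rw [← Real.rpow_le_rpow_iff (hy _) (mul_nonneg (hy 0) (pow_nonneg hρ.le _)) h1σ]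
    have e0 : ∀ z : ℝ, 0 ≤ z → z = z ^ σ * z ^ (1 - σ) := fun z hz => by
      rw [← Real.rpow_add_of_nonneg hz hσ.le h1σ.le, add_sub_cancel, Real.rpow_one]
    have e1 : (ρ ^ j) ^ σ * b ^ j = 1 := by
      rw [← Real.rpow_pow_comm hρ.le, ← mul_pow, hρb, one_pow]
    calc y (j + 1) ^ (1 - σ) ≤ A * b ^ j * y j := h j
      _ ≤ A * b ^ j * (y 0 * ρ ^ j) := by gcongr
      _ = A * b ^ j * ((y 0 ^ σ * y 0 ^ (1 - σ)) * ((ρ ^ j) ^ σ * (ρ ^ j) ^ (1 - σ))) := by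
        rw [← e0 _ (hy 0), ← e0 _ hρj.le]
      _ = (A * y 0 ^ σ) * ((y 0 ^ (1 - σ) * (ρ ^ j) ^ (1 - σ)) * ((ρ ^ j) ^ σ * b ^ j)) := by ring
      _ ≤ ρ ^ (1 - σ) * ((y 0 ^ (1 - σ) * (ρ ^ j) ^ (1 - σ)) * ((ρ ^ j) ^ σ * b ^ j)) := by
        have := hy 0
        gcongr
      _ = (y 0 * ρ ^ (j + 1)) ^ (1 - σ) := by
        rw [e1, mul_one, pow_succ, Real.mul_rpow (hy 0) (by positivity),
          Real.mul_rpow hρj.le hρ.le]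
        ring

lemma MemX.gagliardoEnergy_ne_top {n : ℕ} {s : ℝ}
    {a : sphere (0 : EuclideanSpace ℝ (Fin n)) 1 → ℝ} {Ω : Set (EuclideanSpace ℝ (Fin n))}
    {u : EuclideanSpace ℝ (Fin n) → ℝ} (hu : MemX s a Ω u) (ha : IsAngularWeight a) :
    gagliardoEnergy volume s u ≠ ∞ := by
  obtain ⟨β, hβ, haβ⟩ := ha.inf_pos
  intro htop
  have h := (mul_gagliardoEnergy_le ha hβ haβ hu.memLp.aemeasurable).trans_lt hu.seminorm_lt_top
  rw [htop, ENNReal.mul_top (by simpa using hβ)] at h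
  exact lt_irrefl _ h

lemma MemX.lintegral_rpow_ne_top {n : ℕ} {s σ : ℝ} (hs : 0 < s) (hn : 2 * s < n)
    (hσ : σ = 2 * s / n)
    {a : sphere (0 : EuclideanSpace ℝ (Fin n)) 1 → ℝ} {Ω : Set (EuclideanSpace ℝ (Fin n))}
    {u : EuclideanSpace ℝ (Fin n) → ℝ} (hu : MemX s a Ω u) (ha : IsAngularWeight a) :
    ∫⁻ x, ‖u x‖ₑ ^ (2 / (1 - σ)) ≠ ∞ := by
  have h1σ : 0 < 1 - σ := by
    rw [hσ, sub_pos, div_lt_one (by linarith)]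
    exact hn
  obtain ⟨S, hS⟩ := exists_sobolev_const (volume : Measure (EuclideanSpace ℝ (Fin n))) (s := s)
    (σ := σ) hs (by simpa using hn) (by simpa using hσ)
  intro htop
  have h := (hS u hu.memLp).trans_lt
    (ENNReal.mul_lt_top ENNReal.coe_lt_top (hu.gagliardoEnergy_ne_top ha).lt_top)
  rw [htop, ENNReal.top_rpow_of_pos h1σ] at h
  exact lt_irrefl _ h

/-- The `ε`-regularity principle: if above level `K` the nonlinearity is at most
`lam * t ^ (2* - 1)`, and `lam` times the appropriate power of the critical mass of `u` above `K`
is small, then `u ≤ 2 K`. The levels of the iteration are `K (2 - 2⁻ʲ)`. -/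
theorem exists_eps_forall_ae_le {n : ℕ} {s σ : ℝ} (hs : 0 < s) (hn : 2 * s < n)
    (hσ : σ = 2 * s / n) {β : ℝ} (hβ : 0 < β) :
    ∃ ε : ℝ, 0 < ε ∧ ∀ (a : sphere (0 : EuclideanSpace ℝ (Fin n)) 1 → ℝ)
      (Ω : Set (EuclideanSpace ℝ (Fin n))) (f : EuclideanSpace ℝ (Fin n) → ℝ → ℝ)
      (u : EuclideanSpace ℝ (Fin n) → ℝ), IsAngularWeight a → (∀ θ, β ≤ a θ) →
      IsWeakSolution s a Ω f u → ∀ lam K : ℝ, 0 ≤ lam → 0 < K →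
      (∀ᵐ x ∂(volume.restrict Ω), ∀ t : ℝ, K ≤ t → |f x t| ≤ lam * t ^ (2 / (1 - σ) - 1)) →
      lam * (∫⁻ x, ‖max (u x - K) 0‖ₑ ^ (2 / (1 - σ))).toReal ^ σ ≤ ε →
      ∀ᵐ x, u x ≤ 2 * K := by
  have hn0 : (0 : ℝ) < n := by linarith
  have hσ0 : 0 < σ := by rw [hσ]; positivity
  have hσ1 : σ < 1 := by rw [hσ, div_lt_one hn0]; exact hn
  have h1σ : 0 < 1 - σ := by linarith
  have hp1 : 1 ≤ 2 / (1 - σ) := by rw [le_div_iff₀ h1σ]; linarith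
  obtain ⟨S, hS⟩ := exists_sobolev_const (volume : Measure (EuclideanSpace ℝ (Fin n))) (s := s)
    (σ := σ) hs (by simpa using hn) (by simpa using hσ)
  have hp0 : 0 < 2 / (1 - σ) := by linarith
  set p : ℝ := 2 / (1 - σ) with hp
  set ρ : ℝ := ((2 : ℝ) ^ p) ^ (-1 / σ) with hρ
  have hb0 : (0 : ℝ) < 2 ^ p := by positivity
  have hb1 : (1 : ℝ) < 2 ^ p := Real.one_lt_rpow (by norm_num) hp0
  have hρ0 : 0 < ρ := by positivity
  have hρ1 : ρ < 1 := Real.rpow_lt_one_of_one_lt_of_neg hb1 (div_neg_of_neg_of_pos (by simp) hσ0)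
  have hρb : ρ ^ σ * 2 ^ p = 1 := by
    rw [hρ, ← Real.rpow_mul hb0.le, div_mul_cancel₀ _ hσ0.ne', Real.rpow_neg_one,
      inv_mul_cancel₀ hb0.ne']
  have hden : 0 < S / β * 4 ^ p + 1 := by positivity
  refine ⟨ρ ^ (1 - σ) / (S / β * 4 ^ p + 1), by positivity, ?_⟩
  intro a Ω f u ha haβ hu lam K hlam hK hf hsmall
  set k : ℕ → ℝ := fun j => K * (2 - (1 / 2) ^ j) with hk
  have hk0 : k 0 = K := by simp [hk]; ring
  have hpow1 : ∀ j : ℕ, (1 / 2 : ℝ) ^ j ≤ 1 := fun j => pow_le_one₀ (by norm_num) (by norm_num)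
  have hKk : ∀ j, K ≤ k j := fun j => by
    simp only [hk]; nlinarith [hpow1 j]
  have hk2 : ∀ j, k j ≤ 2 * K := fun j => by
    have : (0 : ℝ) < (1 / 2) ^ j := by positivity
    simp only [hk]; nlinarith
  have hdiff : ∀ j, k (j + 1) - k j = K * (1 / 2) ^ (j + 1) := fun j => by
    simp only [hk]; rw [pow_succ]; ring
  have hklt : ∀ j, k j < k (j + 1) := fun j => by
    have : 0 < K * (1 / 2) ^ (j + 1) := by positivity
    rw [← hdiff] at this
    linarith
  have hX : ∀ h : ℝ, 0 ≤ h → MemX s a Ω (fun x => max (u x - h) 0) := fun h hh =>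
    hu.memX.max_sub ha.nonneg hh
  set Y : ℕ → ℝ≥0∞ := fun j => ∫⁻ x, ‖max (u x - k j) 0‖ₑ ^ p with hY
  have hYt : ∀ j, Y j ≠ ∞ := fun j =>
    (hX (k j) (hK.le.trans (hKk j))).lintegral_rpow_ne_top hs hn hσ ha
  have hrec : ∀ j, (Y (j + 1)).toReal ^ (1 - σ)
      ≤ (S / β * 4 ^ p * lam) * (2 ^ p) ^ j * (Y j).toReal := by
    intro j
    have hj := hX (k (j + 1)) (hK.le.trans (hKk _))
    have h1 := hS _ hj.memLp
    have h2 := hu.mul_gagliardoEnergy_max_sub_le ha hβ haβ hp1 hlam hK.le (hKk j) (hklt j) hf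
    have hGt := hj.gagliardoEnergy_ne_top ha
    have h1' := ENNReal.toReal_mono (ENNReal.mul_ne_top ENNReal.coe_ne_top hGt) h1
    have h2' := ENNReal.toReal_mono (ENNReal.mul_ne_top ENNReal.ofReal_ne_top (hYt j)) h2
    have hratio : 0 ≤ k (j + 1) / (k (j + 1) - k j) :=
      div_nonneg (hK.le.trans (hKk _)) (sub_nonneg.2 (hklt j).le)
    rw [ENNReal.toReal_mul, ENNReal.toReal_ofReal hβ.le, ENNReal.toReal_mul,
      ENNReal.toReal_ofReal (by positivity)] at h2'
    rw [← ENNReal.toReal_rpow, ENNReal.toReal_mul, ENNReal.coe_toReal] at h1'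
    have hratio2 : k (j + 1) / (k (j + 1) - k j) ≤ 4 * 2 ^ j := by
      rw [hdiff, div_le_iff₀ (by positivity)]
      have : (4 * 2 ^ j : ℝ) * (K * (1 / 2) ^ (j + 1)) = 2 * K := by
        rw [pow_succ, one_div, inv_pow]
        field_simp
        norm_num
      rw [this]
      exact hk2 _
    have hratio3 : (k (j + 1) / (k (j + 1) - k j)) ^ p ≤ 4 ^ p * (2 ^ p) ^ j := by
      calc _ ≤ (4 * 2 ^ j : ℝ) ^ p := by gcongr
        _ = _ := by rw [Real.mul_rpow (by norm_num) (by positivity), Real.rpow_pow_comm (by norm_num)]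
    calc (Y (j + 1)).toReal ^ (1 - σ) ≤ S * (gagliardoEnergy volume s
          (fun x => max (u x - k (j + 1)) 0)).toReal := h1'
      _ ≤ S * ((lam * (k (j + 1) / (k (j + 1) - k j)) ^ p * (Y j).toReal) / β) := by
          gcongr
          rw [le_div_iff₀ hβ, mul_comm]
          exact h2'
      _ ≤ S * ((lam * (4 ^ p * (2 ^ p) ^ j) * (Y j).toReal) / β) := by gcongr
      _ = _ := by ring
  have h0 : (S / β * 4 ^ p * lam) * (Y 0).toReal ^ σ ≤ ρ ^ (1 - σ) := by
    have hz : 0 ≤ lam * (Y 0).toReal ^ σ := by positivity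
    have hsm : lam * (Y 0).toReal ^ σ ≤ ρ ^ (1 - σ) / (S / β * 4 ^ p + 1) := by
      simpa only [hY, hk0] using hsmall
    rw [le_div_iff₀ hden] at hsm
    nlinarith
  have hdecay := le_mul_pow_of_superlinear hσ0 hσ1 (y := fun j => (Y j).toReal)
    (fun j => ENNReal.toReal_nonneg) (by positivity) hb0.le hρ0 hρb hrec h0
  have h2K := hX (2 * K) (by positivity)
  have hle : ∀ j, (∫⁻ x, ‖max (u x - 2 * K) 0‖ₑ ^ p).toReal ≤ (Y 0).toReal * ρ ^ j := by
    intro j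
    refine (ENNReal.toReal_mono (hYt j) (lintegral_mono fun x => ?_)).trans (hdecay j)
    refine ENNReal.rpow_le_rpow ?_ hp0.le
    rw [Real.enorm_eq_ofReal (le_max_right _ _), Real.enorm_eq_ofReal (le_max_right _ _)]
    refine ENNReal.ofReal_le_ofReal (max_le_max ?_ le_rfl)
    linarith [hk2 j]
  have hzero : (∫⁻ x, ‖max (u x - 2 * K) 0‖ₑ ^ p).toReal ≤ 0 := by
    refine ge_of_tendsto' (x := Filter.atTop) ?_ hle
    simpa using (tendsto_pow_atTop_nhds_zero_of_lt_one hρ0.le hρ1).const_mul (Y 0).toReal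
  have hzero' : ∫⁻ x, ‖max (u x - 2 * K) 0‖ₑ ^ p = 0 := by
    refine ((ENNReal.toReal_eq_zero_iff _).1 (hzero.antisymm ENNReal.toReal_nonneg)).resolve_right ?_
    exact h2K.lintegral_rpow_ne_top hs hn hσ ha
  rw [lintegral_eq_zero_iff' (h2K.memLp.aemeasurable.enorm.pow_const _)] at hzero'
  filter_upwards [hzero'] with x hx
  simp only [Pi.zero_apply, ENNReal.rpow_eq_zero_iff_of_pos hp0, enorm_eq_zero] at hx
  linarith [max_eq_right_iff.1 hx]

/-! ### Two-sided bounds -/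

section TwoSided

variable {n : ℕ} {s : ℝ} {a : sphere (0 : EuclideanSpace ℝ (Fin n)) 1 → ℝ}
  {Ω : Set (EuclideanSpace ℝ (Fin n))} {f : EuclideanSpace ℝ (Fin n) → ℝ → ℝ}
  {u : EuclideanSpace ℝ (Fin n) → ℝ}

lemma IsWeakSolution.neg (hu : IsWeakSolution s a Ω f u) :
    IsWeakSolution s a Ω (fun x t => -f x (-t)) (fun x => -u x) where
  memX :=
    { memLp := hu.memX.memLp.neg
      seminorm_lt_top := by
        simpa only [neg_sub_neg, abs_sub_comm] using hu.memX.seminorm_lt_top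
      eq_zero := by
        filter_upwards [hu.memX.eq_zero] with x hx
        simp [hx] }
  weak_eq v hv := by
    have h := hu.weak_eq v hv
    simp only [neg_neg, neg_mul, integral_neg, ← h, innerX]
    rw [← integral_neg]
    congr 1 with p
    ring

/-- Above a level `K ≥ 1` a growth condition with exponent `q` is one with exponent `p`, with
constant `2 C K ^ (q - p)`. -/
lemma GrowthCondition.ae_abs_le {C q p K : ℝ} (hf : GrowthCondition Ω f C q) (hC : 0 ≤ C)
    (hq : 1 ≤ q) (hqp : q ≤ p) (hK : 1 ≤ K) :
    ∀ᵐ x ∂(volume.restrict Ω), ∀ t : ℝ, K ≤ |t| →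
      |f x t| ≤ 2 * C * K ^ (q - p) * |t| ^ (p - 1) := by
  filter_upwards [hf] with x hx t ht
  have ht1 : 1 ≤ |t| := hK.trans ht
  have ht0 : 0 < |t| := by linarith
  have h1 : 1 ≤ |t| ^ (q - 1) := Real.one_le_rpow ht1 (by linarith)
  have h2 : |t| ^ (q - 1) = |t| ^ (q - p) * |t| ^ (p - 1) := by
    rw [← Real.rpow_add ht0]; ring_nf
  have h3 : |t| ^ (q - p) ≤ K ^ (q - p) :=
    Real.rpow_le_rpow_of_nonpos (by linarith) ht (by linarith)
  calc |f x t| ≤ C * (1 + |t| ^ (q - 1)) := hx t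
    _ ≤ 2 * C * |t| ^ (q - 1) := by nlinarith
    _ ≤ 2 * C * (K ^ (q - p) * |t| ^ (p - 1)) := by rw [h2]; gcongr
    _ = _ := by ring

/-- The `ε`-regularity principle for `|u|`, under the growth condition. -/
theorem exists_eps_forall_ae_abs_le {n : ℕ} {s σ : ℝ} (hs : 0 < s) (hn : 2 * s < n)
    (hσ : σ = 2 * s / n) {β : ℝ} (hβ : 0 < β) :
    ∃ ε : ℝ, 0 < ε ∧ ∀ (a : sphere (0 : EuclideanSpace ℝ (Fin n)) 1 → ℝ)
      (Ω : Set (EuclideanSpace ℝ (Fin n))) (f : EuclideanSpace ℝ (Fin n) → ℝ → ℝ)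
      (u : EuclideanSpace ℝ (Fin n) → ℝ), IsAngularWeight a → (∀ θ, β ≤ a θ) →
      IsWeakSolution s a Ω f u → ∀ C q : ℝ, 0 ≤ C → 1 ≤ q → q ≤ 2 / (1 - σ) →
      GrowthCondition Ω f C q → ∀ K : ℝ, 1 ≤ K →
      2 * C * K ^ (q - 2 / (1 - σ)) *
        (∫⁻ x, ‖max (|u x| - K) 0‖ₑ ^ (2 / (1 - σ))).toReal ^ σ ≤ ε →
      ∀ᵐ x, |u x| ≤ 2 * K := by
  obtain ⟨ε, hε, H⟩ := exists_eps_forall_ae_le hs hn hσ hβ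
  refine ⟨ε, hε, fun a Ω f u ha haβ hu C q hC hq hqp hf K hK hsmall => ?_⟩
  have hn0 : (0 : ℝ) < n := by linarith
  have hσ0 : 0 < σ := by rw [hσ]; positivity
  have h1σ : 0 < 1 - σ := by
    rw [hσ, sub_pos, div_lt_one hn0]
    exact hn
  have hK0 : 0 < K := by linarith
  have hlam : 0 ≤ 2 * C * K ^ (q - 2 / (1 - σ)) := by positivity
  have hmono : ∀ v : EuclideanSpace ℝ (Fin n) → ℝ, (∀ x, v x ≤ |u x|) →
      2 * C * K ^ (q - 2 / (1 - σ)) *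
        (∫⁻ x, ‖max (v x - K) 0‖ₑ ^ (2 / (1 - σ))).toReal ^ σ ≤ ε := by
    intro v hv
    refine le_trans ?_ hsmall
    have hfin : ∫⁻ x, ‖max (|u x| - K) 0‖ₑ ^ (2 / (1 - σ)) ≠ ∞ := by
      refine ne_top_of_le_ne_top (hu.memX.lintegral_rpow_ne_top hs hn hσ ha)
        (lintegral_mono fun x => ENNReal.rpow_le_rpow ?_ (by positivity))
      rw [Real.enorm_eq_ofReal (le_max_right _ _), Real.enorm_eq_ofReal_abs]
      exact ENNReal.ofReal_le_ofReal (max_le (by linarith) (abs_nonneg _))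
    gcongr with x
    rw [Real.enorm_eq_ofReal (le_max_right _ _), Real.enorm_eq_ofReal (le_max_right _ _)]
    exact ENNReal.ofReal_le_ofReal (max_le_max (by linarith [hv x]) le_rfl)
  have hg := hf.ae_abs_le hC hq hqp hK
  have h1 := H a Ω f u ha haβ hu _ K hlam hK0 (by
    filter_upwards [hg] with x hx t ht
    have := hx t (ht.trans (le_abs_self t))
    rwa [abs_of_pos (hK0.trans_le ht : 0 < t)] at this) (hmono _ fun x => le_abs_self _)
  have h2 := H a Ω _ _ ha haβ hu.neg _ K hlam hK0 (by
    filter_upwards [hg] with x hx t ht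
    have := hx (-t) (by rw [abs_neg]; exact ht.trans (le_abs_self t))
    rwa [abs_neg, abs_of_pos (hK0.trans_le ht : 0 < t), ← abs_neg (f x (-t))] at this)
    (hmono _ fun x => neg_le_abs _)
  filter_upwards [h1, h2] with x hx1 hx2
  exact abs_le'.2 ⟨hx1, hx2⟩

/-- The part of the critical mass above level `K` vanishes as `K → ∞`. -/
lemma tendsto_lintegral_max_abs_sub {α : Type*} [MeasurableSpace α] {μ : Measure α} {u : α → ℝ}
    {p : ℝ} (hp : 0 < p) (hu : AEMeasurable u μ) (hfin : ∫⁻ x, ‖u x‖ₑ ^ p ∂μ ≠ ∞) :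
    Filter.Tendsto (fun K : ℕ => ∫⁻ x, ‖max (|u x| - K) 0‖ₑ ^ p ∂μ) Filter.atTop (nhds 0) := by
  have h := tendsto_lintegral_of_dominated_convergence' (μ := μ)
    (F := fun (K : ℕ) x => ‖max (|u x| - K) 0‖ₑ ^ p) (f := fun _ => 0) (fun x => ‖u x‖ₑ ^ p)
    (fun K => ((((continuous_abs.measurable.comp_aemeasurable hu).sub_const _).max
      aemeasurable_const).enorm).pow_const _)
    (fun K => Filter.Eventually.of_forall fun x => ENNReal.rpow_le_rpow ?_ hp.le) hfin
    (Filter.Eventually.of_forall fun x => ?_)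
  · simpa using h
  · rw [Real.enorm_eq_ofReal (le_max_right _ _), Real.enorm_eq_ofReal_abs]
    exact ENNReal.ofReal_le_ofReal (max_le (by linarith [(Nat.cast_nonneg K : (0 : ℝ) ≤ K)])
      (abs_nonneg _))
  · refine tendsto_const_nhds.congr' ?_
    filter_upwards [Filter.eventually_ge_atTop ⌈|u x|⌉₊] with K hK
    rw [max_eq_right (by linarith [Nat.ceil_le.1 hK]), enorm_zero, ENNReal.zero_rpow_of_pos hp]

lemma MemX.lintegral_restrict (hu : MemX s a Ω u) (hΩ : MeasurableSet Ω) {p : ℝ} (hp : 0 < p) :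
    ∫⁻ x in Ω, ‖u x‖ₑ ^ p = ∫⁻ x, ‖u x‖ₑ ^ p := by
  conv_rhs => rw [← lintegral_add_compl _ hΩ]
  have : ∫⁻ x in Ωᶜ, ‖u x‖ₑ ^ p = 0 := by
    rw [lintegral_congr_ae (g := fun _ => 0), lintegral_zero]
    filter_upwards [hu.eq_zero] with x hx
    simp [hx, hp]
  rw [this, add_zero]

end TwoSided

lemma criticalExponent_eq {n : ℕ} {s : ℝ} (hs : 0 < s) (hn : 2 * s < n) :
    criticalExponent n s = 2 / (1 - 2 * s / n) := by
  have h1 : (0 : ℝ) < n := by linarith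
  have h2 : (n : ℝ) - 2 * s ≠ 0 := by linarith
  rw [criticalExponent, one_sub_div h1.ne', div_div_eq_mul_div]

/-! ### Boundedness of weak solutions -/

theorem theorem4p1 (n : ℕ) (s : ℝ) (hs : s ∈ Ioo (0 : ℝ) 1) (hn : 2 * s < n)
    (Ω : Set (EuclideanSpace ℝ (Fin n))) (hΩ : IsBoundedC11Domain Ω)
    (C q : ℝ) (hC : 0 < C) (hq : q ∈ Icc 1 (criticalExponent n s)) :
    (∀ a : sphere (0 : EuclideanSpace ℝ (Fin n)) 1 → ℝ, IsAngularWeight a →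
      ∀ f : EuclideanSpace ℝ (Fin n) → ℝ → ℝ, IsCaratheodory Ω f → GrowthCondition Ω f C q →
      ∀ u : EuclideanSpace ℝ (Fin n) → ℝ, IsWeakSolution s a Ω f u →
        MemLp u ∞ (volume.restrict Ω)) ∧
    (q < criticalExponent n s → ∀ β : ℝ, 0 < β →
      ∃ M : ℝ≥0 → ℝ≥0, Continuous M ∧
        ∀ a : sphere (0 : EuclideanSpace ℝ (Fin n)) 1 → ℝ, IsAngularWeight a →
        (∀ θ, β ≤ a θ) →
        ∀ f : EuclideanSpace ℝ (Fin n) → ℝ → ℝ, IsCaratheodory Ω f → GrowthCondition Ω f C q →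
        ∀ u : EuclideanSpace ℝ (Fin n) → ℝ, IsWeakSolution s a Ω f u →
          eLpNorm u ∞ (volume.restrict Ω) ≤
            M (eLpNorm u (ENNReal.ofReal (criticalExponent n s)) (volume.restrict Ω)).toNNReal) := by
  obtain ⟨hs0, -⟩ := hs
  have hn0 : (0 : ℝ) < n := by linarith
  rw [criticalExponent_eq hs0 hn] at hq ⊢
  obtain ⟨σ, hσ⟩ : ∃ σ, σ = 2 * s / n := ⟨_, rfl⟩
  rw [← hσ] at hq ⊢
  have hσ0 : 0 < σ := by rw [hσ]; positivity
  have h1σ : 0 < 1 - σ := by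
    rw [hσ, sub_pos, div_lt_one hn0]
    exact hn
  set p : ℝ := 2 / (1 - σ) with hp
  have hp0 : 0 < p := by positivity
  refine ⟨fun a ha f _ hf u hu => ?_, fun hqp β hβ => ?_⟩
  · obtain ⟨β, hβ, haβ⟩ := ha.inf_pos
    obtain ⟨ε, hε, H⟩ := exists_eps_forall_ae_abs_le hs0 hn hσ hβ
    -- at the critical exponent smallness comes from the tail of the critical mass
    have htail := tendsto_lintegral_max_abs_sub hp0 hu.memX.memLp.aemeasurable
      (hu.memX.lintegral_rpow_ne_top hs0 hn hσ ha)
    have hlim : Filter.Tendsto (fun K : ℕ => 2 * C *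
        (∫⁻ x, ‖max (|u x| - K) 0‖ₑ ^ p).toReal ^ σ) Filter.atTop (nhds 0) := by
      have h := (((ENNReal.tendsto_toReal ENNReal.zero_ne_top).comp htail).rpow_const
        (Or.inr hσ0.le)).const_mul (2 * C)
      simpa [Real.zero_rpow hσ0.ne'] using h
    obtain ⟨K, hKε, hK1⟩ := ((hlim.eventually (gt_mem_nhds hε)).and
      (Filter.eventually_ge_atTop 1)).exists
    have hK1' : (1 : ℝ) ≤ K := by exact_mod_cast hK1
    have hb := H a Ω f u ha haβ hu C q hC.le hq.1 hq.2 hf K hK1' (by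
      refine le_trans ?_ hKε.le
      have : (K : ℝ) ^ (q - p) ≤ 1 := Real.rpow_le_one_of_one_le_of_nonpos hK1' (by linarith [hq.2])
      exact mul_le_mul_of_nonneg_right (mul_le_of_le_one_right (by positivity) this)
        (by positivity))
    exact memLp_top_of_bound hu.memX.memLp.1.restrict (2 * K) (ae_restrict_of_ae hb)
  · obtain ⟨ε, hε, H⟩ := exists_eps_forall_ae_abs_le hs0 hn hσ hβ
    -- `t R` is the set of all constants which serve for solutions of critical norm `R`
    let t : ℝ≥0 → Set ℝ := fun R => {c | ∀ a : sphere (0 : EuclideanSpace ℝ (Fin n)) 1 → ℝ,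
      IsAngularWeight a → (∀ θ, β ≤ a θ) →
      ∀ f : EuclideanSpace ℝ (Fin n) → ℝ → ℝ, GrowthCondition Ω f C q →
      ∀ u : EuclideanSpace ℝ (Fin n) → ℝ, IsWeakSolution s a Ω f u →
        (eLpNorm u (ENNReal.ofReal p) (volume.restrict Ω)).toNNReal = R →
          eLpNorm u ∞ (volume.restrict Ω) ≤ ENNReal.ofReal c}
    have ht : ∀ R, Convex ℝ (t R) := fun R => by
      refine (IsUpperSet.ordConnected fun c d hcd hc => ?_).convex
      intro a ha haβ f hf u hu hR
      exact (hc a ha haβ f hf u hu hR).trans (ENNReal.ofReal_le_ofReal hcd)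
    have hloc : ∀ R, ∃ c, ∀ᶠ R' in nhds R, c ∈ t R' := by
      intro R
      -- below the critical exponent smallness comes from the factor `K ^ (q - p)`
      have hlim : Filter.Tendsto (fun K : ℝ => 2 * C * K ^ (q - p) *
          (((R + 1 : ℝ≥0) : ℝ) ^ p) ^ σ) Filter.atTop (nhds 0) := by
        have h := ((tendsto_rpow_neg_atTop (sub_pos.2 hqp)).const_mul (2 * C)).mul_const
          ((((R + 1 : ℝ≥0) : ℝ) ^ p) ^ σ)
        simpa only [neg_sub, mul_zero, zero_mul] using h
      obtain ⟨K, hKε, hK1⟩ := ((hlim.eventually (gt_mem_nhds hε)).and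
        (Filter.eventually_ge_atTop 1)).exists
      refine ⟨2 * K, ?_⟩
      filter_upwards [gt_mem_nhds (lt_add_one R)] with R' hR' a ha haβ f hf u hu hR
      have hfin := hu.memX.lintegral_rpow_ne_top hs0 hn hσ ha
      have hN : (∫⁻ x, ‖u x‖ₑ ^ p).toReal = (R' : ℝ) ^ p := by
        rw [eLpNorm_eq_lintegral_rpow_enorm_toReal (by simpa using hp0) ENNReal.ofReal_ne_top,
          ENNReal.toReal_ofReal hp0.le, hu.memX.lintegral_restrict hΩ.isOpen.measurableSet hp0]
          at hR
        rw [← hR, ENNReal.coe_toNNReal_eq_toReal, ← ENNReal.toReal_rpow,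
          ← Real.rpow_mul ENNReal.toReal_nonneg, one_div_mul_cancel hp0.ne', Real.rpow_one]
      have htail : (∫⁻ x, ‖max (|u x| - K) 0‖ₑ ^ p).toReal ≤ ((R + 1 : ℝ≥0) : ℝ) ^ p := by
        calc _ ≤ (∫⁻ x, ‖u x‖ₑ ^ p).toReal := by
              refine ENNReal.toReal_mono hfin
                (lintegral_mono fun x => ENNReal.rpow_le_rpow ?_ hp0.le)
              rw [Real.enorm_eq_ofReal (le_max_right _ _), Real.enorm_eq_ofReal_abs]
              exact ENNReal.ofReal_le_ofReal (max_le (by linarith) (abs_nonneg _))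
          _ = (R' : ℝ) ^ p := hN
          _ ≤ _ := by
            have : (R' : ℝ) ≤ ((R + 1 : ℝ≥0) : ℝ) := by exact_mod_cast hR'.le
            gcongr
      have hb := H a Ω f u ha haβ hu C q hC.le hq.1 hq.2 hf K hK1 (by
        refine le_trans ?_ hKε.le
        gcongr)
      rw [eLpNorm_exponent_top]
      exact eLpNormEssSup_le_of_ae_bound (ae_restrict_of_ae hb)
    obtain ⟨g, hg⟩ := exists_continuous_forall_mem_convex_of_local_const ht hloc
    exact ⟨fun R => (g R).toNNReal, continuous_real_toNNReal.comp g.continuous,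
      fun a ha haβ f _ hf u hu => hg _ a ha haβ f hf u hu rfl⟩
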